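/- Let $(R,\mathfrak m,k)$ be a Noetherian Cohen--Macaulay local ring of dimension $d$ with uncountable residue field $k$. A maximal Cohen--Macaulay (MCM) module is a nonzero finitely generated $R$-module $M$ for which there is an $M$-regular sequence of length $d$ in $\mathfrak m$. Assume that $R$ has finite or countable CM type, i.e. that there are at most countably many isomorphism classes of indecomposable MCM $R$-modules. Let $\Lambda$ be the set of all ideals $\operatorname{Ann}_R \operatorname{Ext}^i_R(M,N)$ with $i\ge 1$ and $M,N$ indecomposable MCM modules, and let $\Lambda'=\Lambda\setminus\{\mathfrak m,R\}$. An element of $R$ is called general if it lies in no ideal of $\Lambda'$. A system of parameters $\underline x=x_1,\dots,x_d$ (that is, $d$ elements generating an $\mathfrak m$-primary ideal) is called general if the ideal $(\underline x)$ contains a general element. Then: (a) For every general system of parameters $\underline x$ and every ideal $I$ of $R$, $$\mathfrak m\,\bigl((\underline x):((\underline x):I)\bigr)\subseteq (\underline x)+I .$$ (b) More generally, for every general system of parameters $\underline x$, every MCM module $M$ and all ideals $(\underline x)\subseteq \mathfrak a\subseteq I$ of $R$, the ideal $\mathfrak m$ annihilates $$\frac{(\underline x)M:_M(\mathfrak a:I)}{(\underline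 x)M+I\,\bigl((\underline x)M:_M\mathfrak a\bigr)} .$$ (c) If $d\ge 1$, then general systems of parameters exist. (d) The set $\Lambda'$ is a countable set of ideals properly contained in $\mathfrak m$, and for every ideal $K$ generated by a system of parameters and contained in no ideal of $\Lambda'$ (if $d=0$: for $K=0$, without any further condition), and for every ideal $I\supseteq K$, $$K:(K:I)\subseteq I:\mathfrak m .$$ -/

import Mathlib

universe u v

namespace AlmostGorenstein

open CategoryTheory IsLocalRing

/-- A maximal Cohen-Macaulay module over a local ring `R`: a nonzero finitely generated module `M`
with an `M`-regular sequence in the maximal ideal whose length is the dimension of `R`. -/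
structure IsMCM (R : Type u) [CommRing R] [IsLocalRing R]
    (M : Type v) [AddCommGroup M] [Module R M] : Prop where
  nontrivial : Nontrivial M
  finite : Module.Finite R M
  exists_isRegular : ∃ rs : List R, (∀ r ∈ rs, r ∈ maximalIdeal R) ∧
    (rs.length : WithBot ℕ∞) = ringKrullDim R ∧ RingTheory.Sequence.IsRegular M rs

/-- The indecomposable maximal Cohen-Macaulay modules. -/
def indecMCM (R : Type u) [CommRing R] [IsLocalRing R] : Set (ModuleCat.{u} R) :=
  {M | IsMCM R M ∧ Indecomposable M}

/-- At most countable (that is, finite or countably infinite) Cohen-Macaulay type: the set of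
isomorphism classes of indecomposable maximal Cohen-Macaulay modules is countable. -/
def HasCountableCMType (R : Type u) [CommRing R] [IsLocalRing R] : Prop :=
  (Quotient.mk (isIsomorphicSetoid (ModuleCat.{u} R)) '' indecMCM R).Countable

/-- The set `Λ` of the annihilators of the modules `Ext^i(M, N)`, where `i ≥ 1` and `M`, `N` are
indecomposable maximal Cohen-Macaulay modules. -/
def extAnnihilators (R : Type u) [CommRing R] [IsLocalRing R] : Set (Ideal R) :=
  {J | ∃ i : ℕ, 1 ≤ i ∧ ∃ M ∈ indecMCM R, ∃ N ∈ indecMCM R,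
    J = Module.annihilator R (Abelian.Ext M N i)}

/-- The ideals in `Λ` that a general element has to avoid: all of them, except for the maximal ideal
and for the unit ideal (the annihilator of those `Ext` modules that vanish). -/
def avoidedIdeals (R : Type u) [CommRing R] [IsLocalRing R] : Set (Ideal R) :=
  {J ∈ extAnnihilators R | J ≠ ⊤ ∧ J ≠ maximalIdeal R}

def IsGeneralElement {R : Type u} [CommRing R] [IsLocalRing R] (y : R) : Prop :=
  ∀ J ∈ avoidedIdeals R, y ∉ J

/-- A system of parameters: `d = dim R` elements that generate an ideal primary to the maximal
ideal. -/
def IsSystemOfParameters {R : Type u} [CommRing R] [IsLocalRing R] {d : ℕ} (x : Fin d → R) : Prop :=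
  ringKrullDim R = d ∧ (Ideal.span (Set.range x)).radical = maximalIdeal R

/-- A system of parameters such that the ideal it generates contains a general element. -/
def IsGeneralSOP {R : Type u} [CommRing R] [IsLocalRing R] {d : ℕ} (x : Fin d → R) : Prop :=
  IsSystemOfParameters x ∧ ∃ y ∈ Ideal.span (Set.range x), IsGeneralElement y

/-- The submodule `N :_M J` of all `u` in `M` such that `J u ⊆ N`. -/
def moduleColon {R : Type u} [CommRing R] {M : Type v} [AddCommGroup M] [Module R M]
    (N : Submodule R M) (J : Ideal R) : Submodule R M where
  carrier := {u | ∀ r ∈ J, r • u ∈ N}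
  add_mem' ha hb r hr := by
    rw [smul_add]
    exact N.add_mem (ha r hr) (hb r hr)
  zero_mem' r _ := by simp
  smul_mem' c u hu r hr := by
    rw [smul_comm]
    exact N.smul_mem c (hu r hr)

end AlmostGorenstein

open AlmostGorenstein

/-! Let `K = (x)` be a parameter ideal that lies in no avoided ideal, `M` maximal Cohen-Macaulay,
and `L ⊆ Y` finitely generated modules killed by `K`. Then `𝔪` kills `Ext^{d+1}(Y ⧸ L, M)`: this
module is zero or `Ext^1(Z, M)` for a `d`-th syzygy `Z` that is maximal Cohen-Macaulay, and
decomposing `Z` and `M` into indecomposables writes its annihilator as a finite intersection of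
ideals of `Λ`, which contain `K` and hence equal `𝔪` or `R`. Since `Ext^d(-, M) ≅ Hom(-, M ⧸ K M)`
on modules killed by `K`, it follows that `c • φ` extends to `Y` for all `c ∈ 𝔪` and
`φ : L → M ⧸ K M`. For `I = (f₁, …, fₙ)`, the element `(f₁, …, fₙ)` of `Y = (R ⧸ a)ⁿ` generates a
copy `L` of `R ⧸ (a : I)`, so that an element of `K M : (a : I)` gives such a `φ`, whereas a map
out of `Y` sends `(f₁, …, fₙ)` into the image of `I (K M : a)`.

General systems of parameters exist because an uncountable residue field provides uncountably many
combinations `∑ aʲ gⱼ` of the generators of `𝔪`, of which, by the Vandermonde determinant, only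
finitely many lie in a given smaller ideal. In dimension zero all `R ⧸ J` are indecomposable
maximal Cohen-Macaulay modules; hence there are only countably many ideals, so that `𝔪` is
principal and every ideal is a double annihilator. -/

namespace AlmostGorenstein

open CategoryTheory IsLocalRing RingTheory.Sequence Abelian
open scoped Pointwise

section Dimension

variable {R : Type u} [CommRing R] {M L : Type v} [AddCommGroup M] [Module R M]
  [AddCommGroup L] [Module R L]

lemma mem_moduleColon {N : Submodule R M} {J : Ideal R} {u : M} :
    u ∈ moduleColon N J ↔ ∀ r ∈ J, r • u ∈ N :=
  Iff.rfl

lemma map_mem_moduleColon_bot_annihilator (f : L →ₗ[R] M) (u : L) :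
    f u ∈ moduleColon ⊥ (Module.annihilator R L) := fun r hr ↦ by
  rw [← map_smul, Module.mem_annihilator.mp hr u, map_zero]
  exact Submodule.zero_mem _

lemma annihilator_moduleColon_bot_annihilator {f : L →ₗ[R] M} (hf : Function.Injective f) :
    Module.annihilator R (moduleColon (⊥ : Submodule R M) (Module.annihilator R L)) =
      Module.annihilator R L := by
  refine le_antisymm ?_ fun r hr ↦
    Module.mem_annihilator.mpr fun u ↦ Subtype.ext (mem_moduleColon.mp u.2 r hr)
  exact (f.codRestrict _ (map_mem_moduleColon_bot_annihilator f)).annihilator_le_of_injective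
    fun u w h ↦ hf (congrArg Subtype.val h)

lemma injective_quotSMulTop_map_subtype {S : Submodule R M} {y : R}
    (hS : ∀ m : M, y • m ∈ S → m ∈ S) : Function.Injective (QuotSMulTop.map y S.subtype) := by
  rw [← LinearMap.ker_eq_bot, LinearMap.ker_eq_bot']
  intro q hq
  obtain ⟨s, rfl⟩ := Submodule.mkQ_surjective _ q
  have hs : (s : M) ∈ y • (⊤ : Submodule R M) := (Submodule.Quotient.mk_eq_zero _).mp hq
  obtain ⟨m, -, hm⟩ := (Submodule.mem_smul_pointwise_iff_exists _ _ _).mp hs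
  have hmS : m ∈ S := hS m (hm ▸ s.2)
  exact (Submodule.Quotient.mk_eq_zero _).mpr
    ((Submodule.mem_smul_pointwise_iff_exists _ _ _).mpr ⟨⟨m, hmS⟩, trivial, Subtype.ext hm⟩)

lemma ofList_cons_sup_le {x : R} {rs : List R} {I J : Ideal R} (hx : x ∈ J) (hIJ : I ≤ J) :
    Ideal.ofList (x :: rs) ⊔ I ≤ Ideal.ofList rs ⊔ J := by
  rw [Ideal.ofList_cons]
  exact sup_le (sup_le (((Ideal.span_singleton_le_iff_mem J).mpr hx).trans le_sup_right)
    le_sup_left) (hIJ.trans le_sup_right)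

variable [IsLocalRing R]

lemma supportDim_nonpos (h : maximalIdeal R ≤ (Module.annihilator R M).radical) :
    Module.supportDim R M ≤ 0 := by
  have eq_maximalIdeal (p : Module.support R M) : p.1.asIdeal = maximalIdeal R :=
    ((maximalIdeal.isMaximal R).eq_of_le p.1.2.ne_top (h.trans
      (p.1.2.radical_le_iff.mpr (Module.annihilator_le_of_mem_support p.2)))).symm
  have : Subsingleton (Module.support R M) := ⟨fun p q ↦
    Subtype.ext (PrimeSpectrum.ext ((eq_maximalIdeal p).trans (eq_maximalIdeal q).symm))⟩
  exact Order.krullDim_nonpos_of_subsingleton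

variable [IsNoetherianRing R]

lemma supportDim_le_length [Module.Finite R M] {rs : List R} (hmem : ∀ r ∈ rs, r ∈ maximalIdeal R)
    (hrad : maximalIdeal R ≤ (Ideal.ofList rs ⊔ Module.annihilator R M).radical) :
    Module.supportDim R M ≤ rs.length := by
  induction rs generalizing M with
  | nil =>
    rw [Ideal.ofList_nil, bot_sup_eq] at hrad
    exact supportDim_nonpos hrad
  | cons x rs ih =>
    have hquot : Module.supportDim R (QuotSMulTop x M) ≤ rs.length :=
      ih (fun r hr ↦ hmem r (by simp [hr])) (hrad.trans (Ideal.radical_mono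
        (ofList_cons_sup_le (QuotSMulTop.mem_annihilator M x) ((Submodule.mkQ _)
          |>.annihilator_le_of_surjective (Submodule.mkQ_surjective _)))))
    refine (Module.supportDim_le_supportDim_quotSMulTop_succ (hmem x (by simp))).trans ?_
    push_cast [List.length_cons]
    gcongr

/- Induct along the largest submodule `0 :_M ann L` with the same annihilator as `L`: it is
saturated with respect to `M`-regular elements `y`, so that its quotient by `y` embeds in
`M / y M`. -/
lemma length_le_supportDim_of_injective [Module.Finite R M] [Nontrivial L] {rs : List R}
    (hmem : ∀ r ∈ rs, r ∈ maximalIdeal R) (hreg : IsWeaklyRegular M rs) {f : L →ₗ[R] M}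
    (hf : Function.Injective f) : rs.length ≤ Module.supportDim R L := by
  induction rs generalizing M L with
  | nil =>
    have : Nonempty (Module.support R L) := Module.nonempty_support_of_nontrivial.to_subtype
    simpa [Module.supportDim] using Order.krullDim_nonneg
  | cons y rs ih =>
    obtain ⟨hy, hreg⟩ := (isWeaklyRegular_cons_iff M y rs).mp hreg
    have hym : y ∈ maximalIdeal R := hmem y (by simp)
    have : Module.Finite R L := Module.Finite.of_injective f hf
    let S : Submodule R M := moduleColon ⊥ (Module.annihilator R L)
    have : Nontrivial S :=
      (show Function.Injective (f.codRestrict S (map_mem_moduleColon_bot_annihilator f)) from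
        fun u w h ↦ hf (congrArg Subtype.val h)).nontrivial
    have hdim : Module.supportDim R S = Module.supportDim R L := by
      rw [Module.supportDim_eq_ringKrullDim_quotient_annihilator,
        Module.supportDim_eq_ringKrullDim_quotient_annihilator,
        annihilator_moduleColon_bot_annihilator hf]
    have hsat (m : M) (hm : y • m ∈ S) : m ∈ S := fun r hr ↦
      hy ((smul_comm y r m).trans ((hm r hr).trans (smul_zero y).symm))
    have : Nontrivial (QuotSMulTop y S) := nontrivial_quotSMulTop_of_mem_maximalIdeal _ hym
    have hlen := ih (fun r hr ↦ hmem r (by simp [hr])) hreg (injective_quotSMulTop_map_subtype hsat)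
    rw [← hdim, ← Module.supportDim_quotSMulTop_succ_eq_supportDim (hy.submodule S y) hym]
    push_cast [List.length_cons]
    gcongr

lemma isSMulRegular_of_maximalIdeal_le_radical [Module.Finite R M] {x : R} {rs ss : List R}
    (hrs : ∀ r ∈ rs, r ∈ maximalIdeal R)
    (hss : ∀ s ∈ ss, s ∈ maximalIdeal R) (hreg : IsWeaklyRegular M ss)
    (hlen : rs.length < ss.length)
    (hrad : maximalIdeal R ≤ (Ideal.ofList (x :: rs) ⊔ Module.annihilator R M).radical) :
    IsSMulRegular M x := by
  rw [isSMulRegular_iff_right_eq_zero_of_smul]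
  intro v hv
  by_contra hv0
  let L : Submodule R M := Submodule.span R {v}
  have : Nontrivial L := Submodule.nontrivial_iff_ne_bot.mpr (by simpa [L] using hv0)
  have hxL : x ∈ Module.annihilator R L := by
    rw [← Submodule.annihilator, Submodule.mem_annihilator_span_singleton]
    exact hv
  have hle : (ss.length : WithBot ℕ∞) ≤ rs.length :=
    (length_le_supportDim_of_injective hss hreg L.injective_subtype).trans
      (supportDim_le_length hrs (hrad.trans (Ideal.radical_mono (ofList_cons_sup_le hxL
        (L.subtype.annihilator_le_of_injective L.injective_subtype)))))
  exact hlen.not_ge (by exact_mod_cast hle)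

end Dimension

section Ext

open Limits

universe w v' u'

section Abelian

variable {C : Type u'} [Category.{v'} C] [Abelian C] [HasExt.{w} C]

lemma subsingleton_ext_X₃ {S : ShortComplex C} (hS : S.ShortExact) (X : C) (i : ℕ)
    [Subsingleton (Ext X S.X₂ i)] [Subsingleton (Ext X S.X₁ (i + 1))] :
    Subsingleton (Ext X S.X₃ i) :=
  subsingleton_of_forall_eq 0 fun e ↦ by
    obtain ⟨e', rfl⟩ := Ext.covariant_sequence_exact₃ X hS e rfl (Subsingleton.elim _ _)
    rw [Subsingleton.elim e' 0, Ext.zero_comp]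

lemma subsingleton_ext_zero_X₁ {S : ShortComplex C} (hS : S.ShortExact) (X : C)
    [Subsingleton (Ext X S.X₂ 0)] : Subsingleton (Ext X S.X₁ 0) :=
  have := hS.mono_f
  (Ext.postcomp_mk₀_injective_of_mono X S.f).subsingleton

lemma subsingleton_ext_succ_X₁ {S : ShortComplex C} (hS : S.ShortExact) (X : C) (i : ℕ)
    [Subsingleton (Ext X S.X₃ i)] [Subsingleton (Ext X S.X₂ (i + 1))] :
    Subsingleton (Ext X S.X₁ (i + 1)) :=
  subsingleton_of_forall_eq 0 fun e ↦ by
    obtain ⟨e', rfl⟩ := Ext.covariant_sequence_exact₁ X hS e (Subsingleton.elim _ _) rfl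
    rw [Subsingleton.elim e' 0, Ext.zero_comp]

end Abelian

section Linear

variable {R : Type u} [CommRing R] {C : Type u'} [Category.{v'} C] [Abelian C] [Linear R C]
  [HasExt.{w} C]

lemma annihilator_ext_le_of_retract_left {A B : C} {s : A ⟶ B} {p : B ⟶ A} (h : s ≫ p = 𝟙 A)
    (N : C) (i : ℕ) : Module.annihilator R (Ext B N i) ≤ Module.annihilator R (Ext A N i) := by
  refine LinearMap.annihilator_le_of_surjective (Ext.precompOfLinear (Ext.mk₀ s) R N (zero_add i))
    fun e ↦ ⟨(Ext.mk₀ p).comp e (zero_add i), ?_⟩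
  simp [h]

lemma annihilator_ext_le_of_retract_right {A B : C} {s : A ⟶ B} {p : B ⟶ A} (h : s ≫ p = 𝟙 A)
    (N : C) (i : ℕ) : Module.annihilator R (Ext N B i) ≤ Module.annihilator R (Ext N A i) := by
  refine LinearMap.annihilator_le_of_surjective (Ext.postcompOfLinear (Ext.mk₀ p) R N (add_zero i))
    fun e ↦ ⟨e.comp (Ext.mk₀ s) (add_zero i), ?_⟩
  simp [h]

lemma annihilator_ext_eq_of_iso {A A' B B' : C} (f : A ≅ A') (g : B ≅ B') (i : ℕ) :
    Module.annihilator R (Ext A B i) = Module.annihilator R (Ext A' B' i) :=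
  le_antisymm
    ((annihilator_ext_le_of_retract_left f.inv_hom_id B i).trans
      (annihilator_ext_le_of_retract_right g.inv_hom_id A' i))
    ((annihilator_ext_le_of_retract_left f.hom_inv_id B' i).trans
      (annihilator_ext_le_of_retract_right g.hom_inv_id A i))

lemma annihilator_ext_biprod_left (A B N : C) (i : ℕ) :
    Module.annihilator R (Ext (A ⊞ B) N i) =
      Module.annihilator R (Ext A N i) ⊓ Module.annihilator R (Ext B N i) := by
  refine le_antisymm (le_inf (annihilator_ext_le_of_retract_left biprod.inl_fst N i)
    (annihilator_ext_le_of_retract_left biprod.inr_snd N i)) fun r hr ↦ ?_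
  refine Module.mem_annihilator.mpr fun e ↦ Ext.biprod_ext ?_ ?_
  · rw [Ext.comp_smul, Module.mem_annihilator.mp hr.1, Ext.comp_zero]
  · rw [Ext.comp_smul, Module.mem_annihilator.mp hr.2, Ext.comp_zero]

lemma annihilator_ext_biprod_right (A B N : C) (i : ℕ) :
    Module.annihilator R (Ext N (A ⊞ B) i) =
      Module.annihilator R (Ext N A i) ⊓ Module.annihilator R (Ext N B i) := by
  refine le_antisymm (le_inf (annihilator_ext_le_of_retract_right biprod.inl_fst N i)
    (annihilator_ext_le_of_retract_right biprod.inr_snd N i)) fun r hr ↦ ?_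
  refine Module.mem_annihilator.mpr fun e ↦ ?_
  rw [← Ext.comp_mk₀_id (r • e), ← biprod.total, Ext.mk₀_add, Ext.comp_add,
    ← Ext.mk₀_comp_mk₀, ← Ext.mk₀_comp_mk₀, ← Ext.comp_assoc_of_second_deg_zero,
    ← Ext.comp_assoc_of_second_deg_zero, Ext.smul_comp e (Ext.mk₀ biprod.fst),
    Ext.smul_comp e (Ext.mk₀ biprod.snd), Module.mem_annihilator.mp hr.1,
    Module.mem_annihilator.mp hr.2, Ext.zero_comp, Ext.zero_comp, add_zero]

lemma annihilator_ext_X₁_eq_annihilator_ext_X₃ {S : ShortComplex C} (hS : S.ShortExact)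
    [Projective S.X₂] (N : C) (i : ℕ) : Module.annihilator R (Ext S.X₁ N (i + 1)) =
      Module.annihilator R (Ext S.X₃ N (i + 2)) := by
  refine (LinearEquiv.ofBijective (Ext.precompOfLinear hS.extClass R N (by omega))
    ⟨(injective_iff_map_eq_zero _).mpr fun e he ↦ ?_, fun e ↦ ?_⟩).annihilator_eq
  · obtain ⟨e', rfl⟩ := Ext.contravariant_sequence_exact₁ hS N e (by omega) he
    rw [Ext.eq_zero_of_projective e', Ext.comp_zero]
  · exact Ext.contravariant_sequence_exact₃ hS N e (Ext.eq_zero_of_projective _) (by omega)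

end Linear

section Modules

variable {R : Type u} [CommRing R]

lemma annihilator_le_annihilator_ext (X M : ModuleCat.{u} R) (n : ℕ) :
    Module.annihilator R X ≤ Module.annihilator R (Ext X M n) := fun r hr ↦
  Module.mem_annihilator.mpr fun e ↦ by
    have : r • 𝟙 X = 0 := ModuleCat.hom_ext (LinearMap.ext (Module.mem_annihilator.mp hr))
    rw [← Ext.mk₀_id_comp e, ← Ext.smul_comp, ← Ext.mk₀_smul, this, Ext.mk₀_zero, Ext.zero_comp]

variable {X M : ModuleCat.{u} R} {r : R} {rs : List R}

/-- The class of the extension `0 → M → M → M / r M → 0`, where `r` is regular on `M`. -/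
noncomputable def quotSMulTopExtClass (hr : IsSMulRegular M r) :
    Ext (ModuleCat.of R (QuotSMulTop r M)) M 1 :=
  hr.smulShortComplex_shortExact.extClass

lemma exists_comp_quotSMulTopExtClass_eq (hr : IsSMulRegular M r) {i : ℕ} {e : Ext X M (i + 1)}
    (he : r • e = 0) : ∃ e' : Ext X (ModuleCat.of R (QuotSMulTop r M)) i,
      e'.comp (quotSMulTopExtClass hr) rfl = e :=
  Ext.covariant_sequence_exact₁ X hr.smulShortComplex_shortExact e
    ((Ext.smul_eq_comp_mk₀ e r).symm.trans he) rfl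

lemma subsingleton_ext_zero_of_mem_annihilator (hr : IsSMulRegular M r)
    (hrX : r ∈ Module.annihilator R X) : Subsingleton (Ext X M 0) :=
  subsingleton_of_forall_eq 0 fun e ↦ by
    have := hr.smulShortComplex_shortExact.mono_f
    have he : r • e = 0 := Module.mem_annihilator.mp (annihilator_le_annihilator_ext X M 0 hrX) e
    rw [Ext.smul_eq_comp_mk₀] at he
    exact Ext.postcomp_mk₀_injective_of_mono X (ModuleCat.smulShortComplex M r).f
      (he.trans (map_zero _).symm)

lemma subsingleton_ext_of_isWeaklyRegular (hreg : IsWeaklyRegular M rs)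
    (hX : Ideal.ofList rs ≤ Module.annihilator R X) {i : ℕ} (hi : i < rs.length) :
    Subsingleton (Ext X M i) := by
  induction rs generalizing M i with
  | nil => simp at hi
  | cons r rs ih =>
    obtain ⟨hr, hreg⟩ := (isWeaklyRegular_cons_iff M r rs).mp hreg
    rw [Ideal.ofList_cons, sup_le_iff, Ideal.span_singleton_le_iff_mem] at hX
    cases i with
    | zero => exact subsingleton_ext_zero_of_mem_annihilator hr hX.1
    | succ i =>
      have := ih (M := ModuleCat.of R (QuotSMulTop r M)) hreg hX.2 (by simpa using hi)
      refine subsingleton_of_forall_eq 0 fun e ↦ ?_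
      obtain ⟨e', rfl⟩ := exists_comp_quotSMulTopExtClass_eq hr
        (Module.mem_annihilator.mp (annihilator_le_annihilator_ext X M _ hX.1) e)
      rw [Subsingleton.elim e' 0, Ext.zero_comp]

lemma bijective_comp_quotSMulTopExtClass (hr : IsSMulRegular M r)
    (hrX : r ∈ Module.annihilator R X) (n : ℕ) [Subsingleton (Ext X M n)] :
    Function.Bijective fun e : Ext X (ModuleCat.of R (QuotSMulTop r M)) n ↦
      e.comp (quotSMulTopExtClass hr) rfl := by
  refine ⟨(injective_iff_map_eq_zero ((quotSMulTopExtClass hr).postcomp X rfl)).mpr fun e he ↦ ?_,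
    fun e ↦ exists_comp_quotSMulTopExtClass_eq hr
      (Module.mem_annihilator.mp (annihilator_le_annihilator_ext X M _ hrX) e)⟩
  obtain ⟨e', rfl⟩ := Ext.covariant_sequence_exact₃ X hr.smulShortComplex_shortExact e rfl he
  have : Subsingleton (Ext X (ModuleCat.smulShortComplex M r).X₂ n) := ‹Subsingleton (Ext X M n)›
  rw [Subsingleton.elim e' 0]
  exact Ext.zero_comp ..

lemma exists_bijective_mk₀_comp (hreg : IsWeaklyRegular M rs) :
    ∃ δ : Ext (ModuleCat.of R (M ⧸ (Ideal.ofList rs • ⊤ : Submodule R M))) M rs.length,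
      ∀ X : ModuleCat.{u} R, Ideal.ofList rs ≤ Module.annihilator R X →
        Function.Bijective fun φ : X ⟶ ModuleCat.of R (M ⧸ (Ideal.ofList rs • ⊤ : Submodule R M)) ↦
          (Ext.mk₀ φ).comp δ (zero_add _) := by
  induction rs generalizing M with
  | nil =>
    let f : ModuleCat.of R (M ⧸ (Ideal.ofList ([] : List R) • ⊤ : Submodule R M)) ≅ M :=
      (Submodule.quotEquivOfEqBot _ (by rw [Ideal.ofList_nil, Submodule.bot_smul])).toModuleIso
    refine ⟨Ext.mk₀ f.hom, fun X _ ↦ ?_⟩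
    simp only [Ext.mk₀_comp_mk₀]
    exact (Ext.mk₀_bijective X M).comp (f.homToEquiv).bijective
  | cons r rs ih =>
    obtain ⟨hr, hreg'⟩ := (isWeaklyRegular_cons_iff M r rs).mp hreg
    obtain ⟨δ, hδ⟩ := ih (M := ModuleCat.of R (QuotSMulTop r M)) hreg'
    let f := (Submodule.quotOfListConsSMulTopEquivQuotSMulTopInner M r rs).toModuleIso
    refine ⟨(Ext.mk₀ f.hom).comp (δ.comp (quotSMulTopExtClass hr) rfl) (zero_add _),
      fun X hX ↦ ?_⟩
    have := subsingleton_ext_of_isWeaklyRegular hreg hX (i := rs.length) (by simp)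
    rw [Ideal.ofList_cons, sup_le_iff, Ideal.span_singleton_le_iff_mem] at hX
    have hbij := (bijective_comp_quotSMulTopExtClass hr hX.1 rs.length).comp
      ((hδ X hX.2).comp f.homToEquiv.bijective)
    refine Eq.mp (congrArg Function.Bijective (funext fun φ ↦ ?_)) hbij
    refine Eq.trans ?_ (Ext.mk₀_comp_mk₀_assoc φ f.hom
      (δ.comp (quotSMulTopExtClass hr) rfl)).symm
    exact Ext.comp_assoc _ _ _ (zero_add _) rfl (by simp)

lemma exists_linearMap_comp_subtype_eq_smul {Y : ModuleCat.{u} R} (hreg : IsWeaklyRegular M rs)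
    (hY : Ideal.ofList rs ≤ Module.annihilator R Y) (L : Submodule R Y) {c : R}
    (hc : c ∈ Module.annihilator R (Ext (ModuleCat.of R (Y ⧸ L)) M (1 + rs.length)))
    (φ : L →ₗ[R] M ⧸ (Ideal.ofList rs • ⊤ : Submodule R M)) :
    ∃ ψ : Y →ₗ[R] M ⧸ (Ideal.ofList rs • ⊤ : Submodule R M), ψ ∘ₗ L.subtype = c • φ := by
  obtain ⟨δ, hδ⟩ := exists_bijective_mk₀_comp hreg
  let S : ShortComplex (ModuleCat.{u} R) := ModuleCat.shortComplexOfCompEqZero L.subtype L.mkQ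
    (LinearMap.ext fun u ↦ (Submodule.Quotient.mk_eq_zero L).mpr u.2)
  have hS : S.ShortExact := ModuleCat.shortComplex_shortExact S
    (LinearMap.exact_subtype_mkQ L) L.injective_subtype L.mkQ_surjective
  let φ' : S.X₁ ⟶ ModuleCat.of R (M ⧸ (Ideal.ofList rs • ⊤ : Submodule R M)) := ModuleCat.ofHom φ
  obtain ⟨e, he⟩ := Ext.contravariant_sequence_exact₁ hS M
    ((Ext.mk₀ (c • φ')).comp δ (zero_add _)) rfl (by
      rw [Ext.mk₀_smul, Ext.smul_comp, Ext.comp_smul]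
      exact Module.mem_annihilator.mp hc _)
  obtain ⟨ψ, rfl⟩ := (hδ S.X₂ hY).2 e
  have hψ : S.f ≫ ψ = c • φ' :=
    (hδ S.X₁ (hY.trans (L.subtype.annihilator_le_of_injective L.injective_subtype))).1
      ((Ext.mk₀_comp_mk₀_assoc S.f ψ δ).symm.trans he)
  exact ⟨ψ.hom, congrArg ModuleCat.Hom.hom hψ⟩

end Modules

end Ext

section Depth

variable {R : Type u} [CommRing R] [IsLocalRing R] {M : ModuleCat.{u} R} {n d : ℕ} {r : R}
  {rs : List R}

/-- The depth of `M` is at least `n`. The depth is encoded by the vanishing of `Ext^i(k, M)` for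
`i < n`, where `k` is the residue field; in particular, the zero module has infinite depth. -/
def HasDepthGE (M : ModuleCat.{u} R) (n : ℕ) : Prop :=
  ∀ i < n, Subsingleton (Ext (ModuleCat.of R (R ⧸ maximalIdeal R)) M i)

namespace HasDepthGE

lemma of_isWeaklyRegular (hmem : ∀ r ∈ rs, r ∈ maximalIdeal R) (hreg : IsWeaklyRegular M rs) :
    HasDepthGE M rs.length := fun _ hi ↦ by
  refine subsingleton_ext_of_isWeaklyRegular hreg ?_ hi
  rw [Ideal.annihilator_quotient]
  exact Ideal.span_le.mpr hmem

lemma quotSMulTop (hr : IsSMulRegular M r) (h : HasDepthGE M (n + 1)) :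
    HasDepthGE (ModuleCat.of R (QuotSMulTop r M)) n := fun i hi ↦
  have : Subsingleton (Ext _ (ModuleCat.smulShortComplex M r).X₂ i) := h i (by omega)
  have : Subsingleton (Ext _ (ModuleCat.smulShortComplex M r).X₁ (i + 1)) := h (i + 1) (by omega)
  subsingleton_ext_X₃ hr.smulShortComplex_shortExact _ i

lemma X₁ {S : ShortComplex (ModuleCat.{u} R)} (hS : S.ShortExact) (h₂ : HasDepthGE S.X₂ (n + 1))
    (h₃ : HasDepthGE S.X₃ n) : HasDepthGE S.X₁ (n + 1)
  | 0, hi =>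
    have := h₂ 0 hi
    subsingleton_ext_zero_X₁ hS _
  | i + 1, hi =>
    have := h₂ (i + 1) hi
    have := h₃ i (by omega)
    subsingleton_ext_succ_X₁ hS _ i

lemma of_retract {A : ModuleCat.{u} R} {s : A ⟶ M} {p : M ⟶ A} (h : s ≫ p = 𝟙 A)
    (hM : HasDepthGE M n) : HasDepthGE A n := fun i hi ↦ by
  have := hM i hi
  rw [← Module.annihilator_eq_top_iff (R := R)] at this ⊢
  exact top_le_iff.mp (this.ge.trans (annihilator_ext_le_of_retract_right h _ i))

variable [IsNoetherianRing R] [Module.Finite R M]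

lemma exists_isRegular [Nontrivial M] (h : HasDepthGE M n) :
    ∃ rs : List R, rs.length = n ∧ (∀ r ∈ rs, r ∈ maximalIdeal R) ∧ IsRegular M rs := by
  refine ModuleCat.exists_isRegular_of_exists_subsingleton_ext (maximalIdeal R) n M ?_
    (ModuleCat.of R (R ⧸ maximalIdeal R)) ?_ h
  · exact (Submodule.top_ne_ideal_smul_of_le_jacobson_annihilator
      (maximalIdeal_le_jacobson _)).symm.lt_top
  · rw [Module.support_eq_zeroLocus, Ideal.annihilator_quotient]

lemma isWeaklyRegular (h : HasDepthGE M rs.length) (hmem : ∀ r ∈ rs, r ∈ maximalIdeal R)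
    (hrad : maximalIdeal R ≤ (Ideal.ofList rs ⊔ Module.annihilator R M).radical) :
    IsWeaklyRegular M rs := by
  induction rs generalizing M with
  | nil => exact IsWeaklyRegular.nil R M
  | cons x rs ih =>
    have hmem' : ∀ r ∈ rs, r ∈ maximalIdeal R := fun r hr ↦ hmem r (by simp [hr])
    have hx : IsSMulRegular M x := by
      rcases subsingleton_or_nontrivial M with _ | _
      · exact Function.injective_of_subsingleton _
      obtain ⟨ss, hlen, hss, hreg⟩ := h.exists_isRegular
      exact isSMulRegular_of_maximalIdeal_le_radical hmem' hss hreg.toIsWeaklyRegular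
        (by simp [hlen]) hrad
    exact .cons hx (ih (M := ModuleCat.of R (QuotSMulTop x M)) (h.quotSMulTop hx) hmem'
      (hrad.trans (Ideal.radical_mono (ofList_cons_sup_le (QuotSMulTop.mem_annihilator M x)
        ((Submodule.mkQ _).annihilator_le_of_surjective (Submodule.mkQ_surjective _))))))

lemma isMCM [Nontrivial M] (h : HasDepthGE M d) (hd : ringKrullDim R = d) : IsMCM R M := by
  obtain ⟨rs, hlen, hmem, hreg⟩ := h.exists_isRegular
  exact ⟨inferInstance, inferInstance, rs, hmem, by rw [hlen, hd], hreg⟩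

end HasDepthGE

lemma IsMCM.hasDepthGE (hM : IsMCM R M) (hd : ringKrullDim R = d) : HasDepthGE M d := by
  obtain ⟨rs, hmem, hlen, hreg⟩ := hM.exists_isRegular
  obtain rfl : rs.length = d := by exact_mod_cast hlen.trans hd
  exact .of_isWeaklyRegular hmem hreg.toIsWeaklyRegular

lemma IsMCM.hasDepthGE_pi (hR : IsMCM R R) (hd : ringKrullDim R = d) (n : ℕ) :
    HasDepthGE (ModuleCat.of R (Fin n → R)) d := by
  obtain ⟨rs, hmem, hlen, hreg⟩ := hR.exists_isRegular
  obtain rfl : rs.length = d := by exact_mod_cast hlen.trans hd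
  exact .of_isWeaklyRegular hmem (((TensorProduct.rid R (Fin n → R)).isWeaklyRegular_congr rs).mp
    (hreg.toIsWeaklyRegular.isWeaklyRegular_lTensor (M₂ := Fin n → R)))

lemma ofList_ofFn {A : Type*} [Semiring A] (x : Fin d → A) :
    Ideal.ofList (List.ofFn x) = Ideal.span (Set.range x) :=
  congrArg Ideal.span (Set.ext fun _ ↦ List.mem_ofFn' x _)

lemma IsSystemOfParameters.mem_maximalIdeal {x : Fin d → R} (hx : IsSystemOfParameters x)
    (i : Fin d) : x i ∈ maximalIdeal R :=
  hx.2 ▸ Ideal.le_radical (Ideal.subset_span (Set.mem_range_self i))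

variable [IsNoetherianRing R]

lemma IsMCM.isWeaklyRegular {x : Fin d → R} (hM : IsMCM R M) (hx : IsSystemOfParameters x) :
    IsWeaklyRegular M (List.ofFn x) := by
  have := hM.finite
  refine HasDepthGE.isWeaklyRegular (by simpa using hM.hasDepthGE hx.1)
    (List.forall_mem_ofFn_iff.mpr hx.mem_maximalIdeal) ?_
  rw [ofList_ofFn, ← hx.2]
  exact Ideal.radical_mono le_sup_left

lemma IsMCM.exists_syzygy (hR : IsMCM R R) (hd : ringKrullDim R = d) (hn : n < d)
    (C : ModuleCat.{u} R) [Module.Finite R C] (hC : HasDepthGE C n) :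
    ∃ Z : ModuleCat.{u} R, Module.Finite R Z ∧ HasDepthGE Z (n + 1) ∧
      ∀ (N : ModuleCat.{u} R) (i : ℕ),
        Module.annihilator R (Ext Z N (i + 1)) = Module.annihilator R (Ext C N (i + 2)) := by
  obtain ⟨m, f, hf⟩ := Module.Finite.exists_fin' R C
  have hS := LinearMap.shortExact_shortComplexKer hf
  have : Projective f.shortComplexKer.X₂ :=
    (IsProjective.iff_projective (Fin m → R)).mp inferInstance
  exact ⟨f.shortComplexKer.X₁, inferInstanceAs (Module.Finite R (LinearMap.ker f)),
    .X₁ hS (fun i hi ↦ hR.hasDepthGE_pi hd m i (by omega)) hC,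
    annihilator_ext_X₁_eq_annihilator_ext_X₃ hS⟩

lemma IsMCM.exists_iterated_syzygy (hR : IsMCM R R) (hd : ringKrullDim R = d) (hn : n ≤ d)
    (C : ModuleCat.{u} R) [Module.Finite R C] :
    ∃ Z : ModuleCat.{u} R, Module.Finite R Z ∧ HasDepthGE Z n ∧
      ∀ (N : ModuleCat.{u} R) (i : ℕ),
        Module.annihilator R (Ext Z N (i + 1)) = Module.annihilator R (Ext C N (i + n + 1)) := by
  induction n with
  | zero => exact ⟨C, inferInstance, by simp [HasDepthGE], fun N i ↦ rfl⟩
  | succ n ih =>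
    obtain ⟨Z, _, hdepth, hann⟩ := ih (by omega)
    obtain ⟨Z', hZ', hdepth', hann'⟩ := hR.exists_syzygy hd hn Z hdepth
    refine ⟨Z', hZ', hdepth', fun N i ↦ ?_⟩
    rw [hann', hann, add_right_comm i 1 n, add_assoc i n 1]

end Depth

section Decomposition

open Limits TensorProduct

variable {R : Type u} [CommRing R]

lemma not_isZero_iff_nontrivial {A : ModuleCat.{u} R} : ¬ IsZero A ↔ Nontrivial A := by
  rw [ModuleCat.isZero_iff_subsingleton, not_subsingleton_iff_nontrivial]

variable [IsLocalRing R]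

variable (R) in
/-- The dimension of `k ⊗ M` over the residue field `k`, which by Nakayama is the minimal number of
generators of a finite module `M`. -/
noncomputable def fiberRank (M : Type*) [AddCommGroup M] [Module R M] : ℕ :=
  Module.finrank (ResidueField R) (ResidueField R ⊗[R] M)

lemma fiberRank_pos (M : Type*) [AddCommGroup M] [Module R M] [Module.Finite R M] [Nontrivial M] :
    0 < fiberRank R M := by
  have : Nontrivial (ResidueField R ⊗[R] M) := by
    rw [← not_subsingleton_iff_nontrivial, IsLocalRing.subsingleton_tensorProduct]
    exact not_subsingleton M
  exact Module.finrank_pos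

lemma fiberRank_eq_add {M A B : Type*} [AddCommGroup M] [Module R M] [AddCommGroup A] [Module R A]
    [AddCommGroup B] [Module R B] [Module.Finite R A] [Module.Finite R B] (e : M ≃ₗ[R] A × B) :
    fiberRank R M = fiberRank R A + fiberRank R B := by
  have := Module.Free.of_divisionRing (ResidueField R) (ResidueField R ⊗[R] A)
  have := Module.Free.of_divisionRing (ResidueField R) (ResidueField R ⊗[R] B)
  exact ((e.baseChange R (ResidueField R) M (A × B)).trans
    (TensorProduct.prodRight R (ResidueField R) (ResidueField R) A B)).finrank_eq.trans
    (Module.finrank_prod ..)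

variable [IsNoetherianRing R]

lemma IsMCM.of_retract {A M : ModuleCat.{u} R} [Nontrivial A] (hM : IsMCM R M) {s : A ⟶ M}
    {p : M ⟶ A} (h : s ≫ p = 𝟙 A) : IsMCM R A := by
  have := hM.finite
  have : Module.Finite R A := Module.Finite.of_surjective p.hom fun a ↦
    ⟨s a, by rw [← ModuleCat.comp_apply, h, ModuleCat.id_apply]⟩
  obtain ⟨rs, -, hlen, -⟩ := hM.exists_isRegular
  exact ((hM.hasDepthGE hlen.symm).of_retract h).isMCM hlen.symm

lemma IsMCM.decomposition_induction {P : ModuleCat.{u} R → Prop}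
    (indec : ∀ A ∈ indecMCM R, P A)
    (sum : ∀ M A B : ModuleCat.{u} R, (M ≅ A ⊞ B) → P A → P B → P M)
    {M : ModuleCat.{u} R} (hM : IsMCM R M) : P M := by
  induction hn : fiberRank R M using Nat.strong_induction_on generalizing M with
  | _ n ih =>
    by_cases hind : Indecomposable M
    · exact indec M ⟨hM, hind⟩
    have hM0 : ¬ IsZero M := not_isZero_iff_nontrivial.mpr hM.nontrivial
    simp only [Indecomposable, hM0, not_false_eq_true, true_and, not_forall, not_or] at hind
    obtain ⟨A, B, e, hA, hB⟩ := hind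
    rw [not_isZero_iff_nontrivial] at hA hB
    have hA' : IsMCM R A :=
      hM.of_retract (s := biprod.inl ≫ e.inv) (p := e.hom ≫ biprod.fst) (by simp)
    have hB' : IsMCM R B :=
      hM.of_retract (s := biprod.inr ≫ e.inv) (p := e.hom ≫ biprod.snd) (by simp)
    have := hA'.finite
    have := hB'.finite
    have := fiberRank_eq_add (e ≪≫ ModuleCat.biprodIsoProd A B).toLinearEquiv
    have := fiberRank_pos (R := R) A
    have := fiberRank_pos (R := R) B
    exact sum M A B e (ih _ (by omega) hA' rfl) (ih _ (by omega) hB' rfl)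

lemma maximalIdeal_le_annihilator_ext {K : Ideal R} (hK : ∀ J ∈ avoidedIdeals R, ¬ K ≤ J)
    {M N : ModuleCat.{u} R} (hM : IsMCM R M) (hN : IsMCM R N) {i : ℕ} (hi : 1 ≤ i)
    (h : K ≤ Module.annihilator R (Ext M N i)) :
    maximalIdeal R ≤ Module.annihilator R (Ext M N i) := by
  revert h
  refine hM.decomposition_induction (P := fun M ↦ K ≤ Module.annihilator R (Ext M N i) →
    maximalIdeal R ≤ Module.annihilator R (Ext M N i)) (fun A hA ↦ ?_) fun M A B e hA hB ↦ ?_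
  · refine hN.decomposition_induction (P := fun N ↦ K ≤ Module.annihilator R (Ext A N i) →
      maximalIdeal R ≤ Module.annihilator R (Ext A N i)) (fun B hB h ↦ ?_) fun N B C e hB hC ↦ ?_
    · by_contra hm
      exact hK _ ⟨⟨i, hi, A, hA, B, hB, rfl⟩, fun htop ↦ hm (htop ▸ le_top),
        fun heq ↦ hm heq.ge⟩ h
    · rw [annihilator_ext_eq_of_iso (Iso.refl A) e, annihilator_ext_biprod_right, le_inf_iff,
        le_inf_iff]
      exact And.imp hB hC
  · rw [annihilator_ext_eq_of_iso e (Iso.refl N), annihilator_ext_biprod_left, le_inf_iff,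
      le_inf_iff]
    exact And.imp hA hB

lemma maximalIdeal_le_annihilator_ext_succ (hR : IsMCM R R) {d : ℕ} (hd : ringKrullDim R = d)
    {K : Ideal R} (hK : ∀ J ∈ avoidedIdeals R, ¬ K ≤ J) {C M : ModuleCat.{u} R} (hM : IsMCM R M)
    [Module.Finite R C] (hC : K ≤ Module.annihilator R C) :
    maximalIdeal R ≤ Module.annihilator R (Ext C M (d + 1)) := by
  obtain ⟨Z, _, hdepth, hann⟩ := hR.exists_iterated_syzygy hd le_rfl C
  have hann : Module.annihilator R (Ext Z M 1) = Module.annihilator R (Ext C M (d + 1)) :=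
    (hann M 0).trans (by rw [zero_add])
  rw [← hann]
  rcases subsingleton_or_nontrivial Z with _ | _
  · exact le_top.trans ((Module.annihilator_eq_top_iff.mpr inferInstance).ge.trans
      (annihilator_le_annihilator_ext Z M 1))
  · exact maximalIdeal_le_annihilator_ext hK (hdepth.isMCM hd) hM le_rfl
      (hann ▸ hC.trans (annihilator_le_annihilator_ext C M (d + 1)))

end Decomposition

section Colon

variable {R : Type u} [CommRing R]

lemma map_mkQ_moduleColon {M : Type v} [AddCommGroup M] [Module R M] (N : Submodule R M)
    (J : Ideal R) : (moduleColon N J).map N.mkQ = moduleColon ⊥ J := by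
  have (u : M) : N.mkQ u ∈ moduleColon ⊥ J ↔ u ∈ moduleColon N J :=
    forall₂_congr fun r _ ↦ (Submodule.Quotient.mk_eq_zero N (x := r • u))
  rw [← Submodule.map_comap_eq_of_surjective N.mkQ_surjective (moduleColon ⊥ J)]
  exact congrArg _ (Submodule.ext this).symm

lemma sup_smul_moduleColon_le {M : Type v} [AddCommGroup M] [Module R M] (N : Submodule R M)
    (a I : Ideal R) : N ⊔ I • moduleColon N a ≤ moduleColon N (a.colon (I : Set R)) := by
  refine sup_le (fun u hu r _ ↦ N.smul_mem r hu) (Submodule.smul_le.mpr fun s hs u hu r hr ↦ ?_)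
  rw [smul_smul]
  exact hu _ (Submodule.mem_colon.mp hr s hs)

lemma le_annihilator_quotient_submoduleOf {M : Type v} [AddCommGroup M] [Module R M]
    {A B : Submodule R M} {J : Ideal R} (h : J • A ≤ B) :
    J ≤ Module.annihilator R (A ⧸ B.submoduleOf A) := fun c hc ↦ by
  refine Module.mem_annihilator.mpr fun q ↦ ?_
  obtain ⟨u, rfl⟩ := Submodule.mkQ_surjective _ q
  exact (Submodule.Quotient.mk_eq_zero _).mpr (h (Submodule.smul_mem_smul hc u.2))

lemma le_annihilator_pi_quotient (a : Ideal R) (ι : Type*) :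
    a ≤ Module.annihilator R (ι → R ⧸ a) := by
  rw [Module.annihilator_pi]
  exact le_iInf fun _ ↦ Ideal.annihilator_quotient.ge

lemma apply_mk_mem_smul_moduleColon_bot {M : Type v} [AddCommGroup M] [Module R M] {ι : Type*}
    [Finite ι] {a I : Ideal R} (ψ : (ι → R ⧸ a) →ₗ[R] M) {f : ι → R} (hf : ∀ j, f j ∈ I) :
    ψ (fun j ↦ Ideal.Quotient.mk a (f j)) ∈ I • moduleColon (⊥ : Submodule R M) a := by
  classical
  have := Fintype.ofFinite ι
  let e (j : ι) : ι → R ⧸ a := Pi.single j 1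
  have hsum : (fun j ↦ Ideal.Quotient.mk a (f j)) = ∑ j, f j • e j := by
    funext j
    simp [e, Finset.sum_apply, Pi.single_apply, Algebra.smul_def]
  rw [hsum, map_sum]
  refine Submodule.sum_mem _ fun j _ ↦ ?_
  rw [map_smul]
  refine Submodule.smul_mem_smul (hf j) fun r hr ↦ ?_
  rw [Submodule.mem_bot, ← map_smul,
    Module.mem_annihilator.mp (le_annihilator_pi_quotient a ι hr), map_zero]

lemma smul_mk_eq_zero_iff_mem_colon {ι : Type*} {a : Ideal R} {f : ι → R} {r : R} :
    r • (fun j ↦ Ideal.Quotient.mk a (f j)) = 0 ↔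
      r ∈ a.colon (Ideal.span (Set.range f) : Set R) := by
  rw [Ideal.colon_span, Submodule.mem_colon, Set.forall_mem_range, funext_iff]
  exact forall_congr' fun j ↦ Ideal.Quotient.eq_zero_iff_mem (I := a) (a := r • f j)

variable [IsLocalRing R]

lemma le_colon_maximalIdeal {I J : Ideal R}
    (h : maximalIdeal R * J ≤ I) : J ≤ I.colon (maximalIdeal R : Set R) :=
  fun z hz ↦ Submodule.mem_colon.mpr fun c hc ↦ by
    rw [smul_eq_mul, mul_comm]
    exact h (Ideal.mul_mem_mul hc hz)

variable [IsNoetherianRing R] {d : ℕ} {x : Fin d → R}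

lemma exists_linearMap_comp_subtype_eq_smul_of_mem_maximalIdeal (hR : IsMCM R R)
    (hx : IsSystemOfParameters x)
    (hK : ∀ J ∈ avoidedIdeals R, ¬ Ideal.span (Set.range x) ≤ J)
    {M : Type u} [AddCommGroup M] [Module R M] (hM : IsMCM R M)
    {Y : Type u} [AddCommGroup Y] [Module R Y] [Module.Finite R Y]
    (hY : Ideal.span (Set.range x) ≤ Module.annihilator R Y) {L : Submodule R Y}
    (φ : L →ₗ[R] M ⧸ (Ideal.span (Set.range x) • ⊤ : Submodule R M)) {c : R}
    (hc : c ∈ maximalIdeal R) :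
    ∃ ψ : Y →ₗ[R] M ⧸ (Ideal.span (Set.range x) • ⊤ : Submodule R M),
      ψ ∘ₗ L.subtype = c • φ := by
  have hreg := IsMCM.isWeaklyRegular (M := ModuleCat.of R M) hM hx
  have hc' : c ∈ Module.annihilator R
      (Ext (ModuleCat.of R (Y ⧸ L)) (ModuleCat.of R M) (1 + (List.ofFn x).length)) := by
    rw [List.length_ofFn, add_comm]
    exact maximalIdeal_le_annihilator_ext_succ hR hx.1 hK (M := ModuleCat.of R M) hM
      (hY.trans (L.mkQ.annihilator_le_of_surjective L.mkQ_surjective)) hc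
  have hofList := ofList_ofFn x
  generalize Ideal.span (Set.range x) = K at *
  subst hofList
  exact exists_linearMap_comp_subtype_eq_smul (Y := ModuleCat.of R Y) hreg hY L hc' φ

lemma maximalIdeal_smul_moduleColon_le (hR : IsMCM R R) (hx : IsSystemOfParameters x)
    (hK : ∀ J ∈ avoidedIdeals R, ¬ Ideal.span (Set.range x) ≤ J)
    {M : Type u} [AddCommGroup M] [Module R M] (hM : IsMCM R M) {a : Ideal R}
    (hxa : Ideal.span (Set.range x) ≤ a) (I : Ideal R) :
    maximalIdeal R • moduleColon (Ideal.span (Set.range x) • (⊤ : Submodule R M)) (a.colon I) ≤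
      Ideal.span (Set.range x) • (⊤ : Submodule R M) ⊔
        I • moduleColon (Ideal.span (Set.range x) • (⊤ : Submodule R M)) a := by
  refine Submodule.smul_le.mpr fun c hc m hm ↦ ?_
  obtain ⟨n, f, rfl⟩ := Submodule.fg_iff_exists_fin_generating_family.mp (IsNoetherian.noetherian I)
  set N := Ideal.span (Set.range x) • (⊤ : Submodule R M)
  let y : Fin n → R ⧸ a := fun j ↦ Ideal.Quotient.mk a (f j)
  have hy (r : R) (hr : r • y = 0) : r • N.mkQ m = 0 :=
    (Submodule.Quotient.mk_eq_zero N).mpr (hm r (smul_mk_eq_zero_iff_mem_colon.mp hr))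
  let φ := (LinearPMap.mkSpanSingleton' (σ := RingHom.id R) y (N.mkQ m) hy).toFun
  obtain ⟨ψ, hψ⟩ := exists_linearMap_comp_subtype_eq_smul_of_mem_maximalIdeal hR hx hK hM
    (hxa.trans (le_annihilator_pi_quotient a (Fin n))) φ hc
  have hψy : ψ y = N.mkQ (c • m) := by
    have hyL : y ∈ Submodule.span R {y} := Submodule.mem_span_singleton_self y
    have hφ : φ ⟨y, hyL⟩ = N.mkQ m := LinearPMap.mkSpanSingleton'_apply_self y _ hy hyL
    rw [map_smul, ← hφ]
    exact LinearMap.congr_fun hψ ⟨y, hyL⟩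
  have hmem := apply_mk_mem_smul_moduleColon_bot ψ fun j ↦
    Ideal.subset_span (Set.mem_range_self (f := f) j)
  rw [← map_mkQ_moduleColon, ← Submodule.map_smul''] at hmem
  rw [← Submodule.comap_map_mkQ, Submodule.mem_comap, ← hψy]
  exact hmem

lemma maximalIdeal_mul_colon_colon_le (hR : IsMCM R R) (hx : IsSystemOfParameters x)
    (hK : ∀ J ∈ avoidedIdeals R, ¬ Ideal.span (Set.range x) ≤ J) (I : Ideal R) :
    maximalIdeal R *
        (Ideal.span (Set.range x)).colon ((Ideal.span (Set.range x)).colon (I : Set R) : Set R) ≤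
      Ideal.span (Set.range x) ⊔ I := by
  have h := maximalIdeal_smul_moduleColon_le hR hx hK hR le_rfl I
  rw [smul_eq_mul (b := ⊤), Ideal.mul_top] at h
  refine (Ideal.mul_mono_right fun z hz r hr ↦ ?_).trans
    (h.trans (sup_le_sup_left Ideal.mul_le_left _))
  rw [smul_eq_mul, mul_comm]
  exact Submodule.mem_colon.mp hz r hr

end Colon

section Avoidance

variable {R : Type u} [CommRing R] [IsLocalRing R]

lemma isUnit_det_vandermonde {n : ℕ} {a : Fin n → R}
    (ha : Function.Injective fun i ↦ residue R (a i)) : IsUnit (Matrix.vandermonde a).det := by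
  have hmap : (Matrix.vandermonde a).map (residue R) = Matrix.vandermonde fun i ↦ residue R (a i) :=
    Matrix.ext fun i j ↦ map_pow (residue R) (a i) j
  rw [← residue_ne_zero_iff_isUnit, RingHom.map_det, RingHom.mapMatrix_apply, hmap]
  exact Matrix.det_vandermonde_ne_zero_iff.mpr ha

lemma span_range_le_of_sum_pow_mul_mem {n : ℕ} {a g : Fin n → R} {J : Ideal R}
    (ha : Function.Injective fun i ↦ residue R (a i))
    (hJ : ∀ i, ∑ j : Fin n, a i ^ (j : ℕ) * g j ∈ J) : Ideal.span (Set.range g) ≤ J := by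
  set V := Matrix.vandermonde a
  have hg : V⁻¹.mulVec (V.mulVec g) = g := by
    rw [Matrix.mulVec_mulVec, Matrix.nonsing_inv_mul V (isUnit_det_vandermonde ha),
      Matrix.one_mulVec]
  have hmem (i) : V⁻¹.mulVec (V.mulVec g) i ∈ J := by
    change ∑ j, V⁻¹ i j * V.mulVec g j ∈ J
    exact J.sum_mem fun j _ ↦ J.mul_mem_left _ (hJ j)
  exact Ideal.span_le.mpr (Set.range_subset_iff.mpr fun i ↦ congr_fun hg i ▸ hmem i)

lemma exists_mem_forall_notMem [Uncountable (ResidueField R)] {I : Ideal R} (hI : I.FG)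
    {S : Set (Ideal R)} (hS : S.Countable) (hSI : ∀ J ∈ S, ¬ I ≤ J) :
    ∃ y ∈ I, ∀ J ∈ S, y ∉ J := by
  obtain ⟨n, g, rfl⟩ := Submodule.fg_iff_exists_fin_generating_family.mp hI
  choose σ hσ using residue_surjective (R := R)
  let y : ResidueField R → R := fun c ↦ ∑ j : Fin n, σ c ^ (j : ℕ) * g j
  have hfin (J) (hJ : J ∈ S) : {c | y c ∈ J}.Finite := by
    by_contra hinf
    let c : Fin n → {c | y c ∈ J} := fun i ↦ Set.Infinite.natEmbedding _ hinf i
    have hc : Function.Injective c :=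
      (Set.Infinite.natEmbedding _ hinf).injective.comp Fin.val_injective
    refine hSI J hJ (span_range_le_of_sum_pow_mul_mem (a := fun i ↦ σ (c i)) ?_ fun i ↦ (c i).2)
    simpa only [hσ, Function.comp_def] using Subtype.val_injective.comp hc
  by_contra! hcover
  refine Set.not_countable_univ ((hS.biUnion fun J hJ ↦ (hfin J hJ).countable).mono fun c _ ↦ ?_)
  obtain ⟨J, hJ, hyJ⟩ := hcover (y c) <| Ideal.sum_mem _ fun j _ ↦
    Ideal.mul_mem_left _ _ (Ideal.subset_span ⟨j, rfl⟩)
  exact Set.mem_biUnion hJ hyJ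

end Avoidance

section Parameters

lemma exists_isSystemOfParameters (R : Type u) [CommRing R] [IsLocalRing R] [IsNoetherianRing R] :
    ∃ (d : ℕ) (x : Fin d → R), IsSystemOfParameters x := by
  obtain ⟨s, hs, hcard⟩ := (maximalIdeal R).exists_finset_card_eq_height_of_isNoetherianRing
  have hrange : Set.range (fun i ↦ (s.equivFin.symm i : R)) = s :=
    (EquivLike.range_comp Subtype.val s.equivFin.symm).trans Subtype.range_coe
  refine ⟨s.card, fun i ↦ s.equivFin.symm i, ?_, ?_⟩
  · rw [← maximalIdeal_height_eq_ringKrullDim, ← hcard]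
    rfl
  · rw [hrange, Ideal.radical_eq_sInf]
    refine le_antisymm (sInf_le ⟨hs.1.2, inferInstance⟩) (le_sInf fun p hp ↦ ?_)
    exact hs.2 ⟨hp.2, hp.1⟩ (le_maximalIdeal hp.2.ne_top)

variable {R : Type u} [CommRing R] [IsLocalRing R]

lemma ringKrullDim_quotient_span_singleton_add_one [IsNoetherianRing R] {y : R}
    (hy : y ∈ maximalIdeal R) (hmin : ∀ p ∈ minimalPrimes R, y ∉ p) :
    ringKrullDim (R ⧸ Ideal.span {y}) + 1 = ringKrullDim R := by
  have hann : Module.annihilator R R = ⊥ := Module.annihilator_eq_bot.mpr inferInstance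
  have hquot : (y • ⊤ : Submodule R R) = Ideal.span {y} := by
    rw [← Submodule.ideal_span_singleton_smul, smul_eq_mul, Ideal.mul_top]
  rw [← Module.supportDim_quotient_eq_ringKrullDim,
    ← Module.supportDim_eq_of_equiv (Submodule.quotEquivOfEq _ _ hquot),
    ← Module.supportDim_self_eq_ringKrullDim (R := R)]
  exact Module.supportDim_quotSMulTop_succ_eq_of_notMem_minimalPrimes_of_mem_maximalIdeal
    (by rwa [hann]) hy

lemma exists_isSystemOfParameters_of_notMem_minimalPrimes [IsNoetherianRing R] {y : R}
    (hy : y ∈ maximalIdeal R) (hmin : ∀ p ∈ minimalPrimes R, y ∉ p) :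
    ∃ (d : ℕ) (x : Fin d → R), IsSystemOfParameters x ∧ y ∈ Ideal.span (Set.range x) := by
  set π := Ideal.Quotient.mk (Ideal.span {y})
  have hπ : Function.Surjective π := Ideal.Quotient.mk_surjective
  have : Nontrivial (R ⧸ Ideal.span {y}) := Ideal.Quotient.nontrivial_iff.mpr
    (Ideal.span_singleton_ne_top hy)
  have : IsLocalRing (R ⧸ Ideal.span {y}) := IsLocalRing.of_surjective' π hπ
  obtain ⟨d, x, hdim, hrad⟩ := exists_isSystemOfParameters (R ⧸ Ideal.span {y})
  obtain ⟨z, rfl⟩ : ∃ z : Fin d → R, x = π ∘ z :=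
    ⟨_, (funext fun i ↦ Function.surjInv_eq hπ (x i)).symm⟩
  have hspan : Ideal.span (Set.range (Fin.cons y z : Fin (d + 1) → R)) =
      (Ideal.span (Set.range (π ∘ z))).comap π := by
    rw [Set.range_comp, ← Ideal.map_span, Ideal.comap_map_of_surjective' _ hπ, Ideal.mk_ker,
      Fin.range_cons, Ideal.span_insert, sup_comm]
  refine ⟨d + 1, Fin.cons y z, ⟨?_, ?_⟩, Ideal.subset_span ⟨0, rfl⟩⟩
  · rw [← ringKrullDim_quotient_span_singleton_add_one hy hmin, hdim, Nat.cast_succ]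
  · rw [hspan, ← Ideal.comap_radical, hrad]
    exact eq_maximalIdeal (Ideal.comap_isMaximal_of_surjective π hπ)

lemma maximalIdeal_notMem_minimalPrimes (hdim : ringKrullDim R ≠ 0) :
    maximalIdeal R ∉ minimalPrimes R := by
  refine fun hmin ↦ hdim <| ringKrullDimZero_iff_ringKrullDim_eq_zero.mp <|
    Ring.krullDimLE_zero_iff_forall_minimalPrimes_isMaximal.mpr fun p hp ↦ ?_
  have hpm : p ≤ maximalIdeal R := le_maximalIdeal hp.1.1.ne_top
  rw [hpm.antisymm (hmin.2 hp.1 hpm)]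
  exact maximalIdeal.isMaximal R

lemma countable_avoidedIdeals (htype : HasCountableCMType R) : (avoidedIdeals R).Countable := by
  let classes := Quotient.mk (isIsomorphicSetoid (ModuleCat.{u} R)) '' indecMCM R
  have hcountable : (⋃ i : ℕ, Set.image2
      (fun p q ↦ Module.annihilator R (Ext p.out q.out i)) classes classes).Countable :=
    Set.countable_iUnion fun i ↦ htype.image2 htype _
  refine hcountable.mono ?_
  rintro _ ⟨⟨i, -, M, hM, N, hN, rfl⟩, -⟩
  obtain ⟨e⟩ : IsIsomorphic _ M := Quotient.mk_out (s := isIsomorphicSetoid _) M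
  obtain ⟨f⟩ : IsIsomorphic _ N := Quotient.mk_out (s := isIsomorphicSetoid _) N
  exact Set.mem_iUnion.mpr ⟨i, _, ⟨M, hM, rfl⟩, _, ⟨N, hN, rfl⟩, annihilator_ext_eq_of_iso e f i⟩

lemma lt_maximalIdeal_of_mem_avoidedIdeals {J : Ideal R} (hJ : J ∈ avoidedIdeals R) :
    J < maximalIdeal R :=
  (le_maximalIdeal hJ.2.1).lt_of_ne hJ.2.2

lemma exists_isGeneralSOP [IsNoetherianRing R] (htype : HasCountableCMType R)
    [Uncountable (ResidueField R)] (hdim : ringKrullDim R ≠ 0) :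
    ∃ (d : ℕ) (x : Fin d → R), IsGeneralSOP x := by
  have hcountable : (avoidedIdeals R ∪ minimalPrimes R).Countable :=
    (countable_avoidedIdeals htype).union (minimalPrimes.finite_of_isNoetherianRing R).countable
  have hlt : ∀ J ∈ avoidedIdeals R ∪ minimalPrimes R, J < maximalIdeal R := by
    rintro J (hJ | hJ)
    · exact lt_maximalIdeal_of_mem_avoidedIdeals hJ
    · refine (le_maximalIdeal hJ.1.1.ne_top).lt_of_ne ?_
      rintro rfl
      exact maximalIdeal_notMem_minimalPrimes hdim hJ
  obtain ⟨y, hym, hy⟩ := exists_mem_forall_notMem (IsNoetherian.noetherian (maximalIdeal R))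
    hcountable fun J hJ ↦ (hlt J hJ).not_ge
  obtain ⟨d, x, hx, hyx⟩ := exists_isSystemOfParameters_of_notMem_minimalPrimes hym
    fun p hp ↦ hy p (Or.inr hp)
  exact ⟨d, x, hx, y, hyx, fun J hJ ↦ hy J (Or.inl hJ)⟩

lemma IsGeneralSOP.not_span_le {d : ℕ} {x : Fin d → R} (hx : IsGeneralSOP x) (J : Ideal R)
    (hJ : J ∈ avoidedIdeals R) : ¬ Ideal.span (Set.range x) ≤ J :=
  let ⟨_, _, hyx, hy⟩ := hx
  fun hle ↦ hy J hJ (hle hyx)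

end Parameters

section DimensionZero

variable {R : Type u} [CommRing R] [IsLocalRing R]

lemma fiberRank_quotient_le_one (J : Ideal R) : fiberRank R (R ⧸ J) ≤ 1 := by
  have h := LinearMap.finrank_le_finrank_of_surjective (f := J.mkQ.baseChange (ResidueField R))
    (LinearMap.lTensor_surjective _ J.mkQ_surjective)
  rwa [Module.finrank_baseChange (M' := R), Module.finrank_self] at h

lemma indecomposable_quotient {J : Ideal R} (hJ : J ≠ ⊤) :
    Indecomposable (ModuleCat.of R (R ⧸ J)) := by
  have hnontrivial : Nontrivial (R ⧸ J) := Ideal.Quotient.nontrivial_iff.mpr hJ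
  refine ⟨not_isZero_iff_nontrivial.mpr hnontrivial, fun A B e ↦ ?_⟩
  let e' : (R ⧸ J) ≃ₗ[R] A × B := (e ≪≫ ModuleCat.biprodIsoProd A B).toLinearEquiv
  have : Module.Finite R (A × B) := Module.Finite.equiv e'
  have : Module.Finite R A := .of_surjective (LinearMap.fst R A B) LinearMap.fst_surjective
  have : Module.Finite R B := .of_surjective (LinearMap.snd R A B) LinearMap.snd_surjective
  by_contra! hAB
  have := not_isZero_iff_nontrivial.mp hAB.1
  have := not_isZero_iff_nontrivial.mp hAB.2
  have hadd := fiberRank_eq_add e'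
  have hle := fiberRank_quotient_le_one J
  have hA := fiberRank_pos (R := R) A
  have hB := fiberRank_pos (R := R) B
  lia

lemma quotient_mem_indecMCM (hdim : ringKrullDim R = 0) {J : Ideal R} (hJ : J ≠ ⊤) :
    ModuleCat.of R (R ⧸ J) ∈ indecMCM R :=
  have hnontrivial : Nontrivial (R ⧸ J) := Ideal.Quotient.nontrivial_iff.mpr hJ
  ⟨⟨hnontrivial, inferInstanceAs (Module.Finite R (R ⧸ J)), [], by simp, by simp [hdim],
    IsRegular.nil R (R ⧸ J)⟩, indecomposable_quotient hJ⟩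

lemma countable_ideals (htype : HasCountableCMType R) (hdim : ringKrullDim R = 0) :
    {J : Ideal R | J ≠ ⊤}.Countable := by
  refine Set.MapsTo.countable_of_injOn
    (f := fun J ↦ Quotient.mk (isIsomorphicSetoid (ModuleCat.{u} R)) (ModuleCat.of R (R ⧸ J)))
    (fun J hJ ↦ Set.mem_image_of_mem _ (quotient_mem_indecMCM hdim hJ)) (fun J _ J' _ h ↦ ?_) htype
  obtain ⟨e⟩ : IsIsomorphic (ModuleCat.of R (R ⧸ J)) (ModuleCat.of R (R ⧸ J')) :=
    Quotient.exact (s := isIsomorphicSetoid _) h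
  have hann : Module.annihilator R (R ⧸ J) = Module.annihilator R (R ⧸ J') :=
    e.toLinearEquiv.annihilator_eq
  rwa [Ideal.annihilator_quotient, Ideal.annihilator_quotient] at hann

lemma exists_maximalIdeal_eq_span_singleton [IsNoetherianRing R] [Uncountable (ResidueField R)]
    (htype : HasCountableCMType R) (hdim : ringKrullDim R = 0) :
    ∃ t : R, maximalIdeal R = Ideal.span {t} := by
  have hcountable : {J : Ideal R | J < maximalIdeal R}.Countable :=
    (countable_ideals htype hdim).mono fun J (hJ : J < _) ↦ (hJ.trans_le le_top).ne
  obtain ⟨t, ht, hlt⟩ := exists_mem_forall_notMem (IsNoetherian.noetherian (maximalIdeal R))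
    hcountable fun J hJ ↦ hJ.not_ge
  have hle : Ideal.span {t} ≤ maximalIdeal R := (Ideal.span_singleton_le_iff_mem _).mpr ht
  exact ⟨t, (hle.eq_of_not_lt fun h ↦ hlt _ h (Ideal.mem_span_singleton_self t)).symm⟩

lemma exists_eq_pow_mul_isUnit {t : R} (ht : maximalIdeal R = Ideal.span {t})
    (hnil : IsNilpotent t) (z : R) : ∃ (j : ℕ) (w : R), IsUnit w ∧ z = t ^ j * w := by
  obtain ⟨n, hn⟩ := hnil
  rcases eq_or_ne z 0 with rfl | hz
  · exact ⟨n, 1, isUnit_one, by rw [hn, zero_mul]⟩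
  · have hfin : FiniteMultiplicity t z :=
      ⟨n, fun h ↦ hz (zero_dvd_iff.mp (by rwa [pow_succ, hn, zero_mul] at h))⟩
    obtain ⟨w, hzw, hw⟩ := hfin.exists_eq_pow_mul_and_not_dvd
    rw [← Ideal.mem_span_singleton, ← ht, notMem_maximalIdeal] at hw
    exact ⟨_, w, hw, hzw⟩

lemma exists_eq_span_singleton_pow {t : R} (ht : maximalIdeal R = Ideal.span {t})
    (hnil : IsNilpotent t) (I : Ideal R) : ∃ i : ℕ, I = Ideal.span {t ^ i} := by
  classical
  have hex : ∃ i, t ^ i ∈ I := hnil.imp fun n (hn : t ^ n = 0) ↦ hn ▸ I.zero_mem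
  refine ⟨Nat.find hex, le_antisymm (fun z hz ↦ ?_)
    ((Ideal.span_singleton_le_iff_mem I).mpr (Nat.find_spec hex))⟩
  obtain ⟨j, w, hw, rfl⟩ := exists_eq_pow_mul_isUnit ht hnil z
  have hj : Nat.find hex ≤ j := Nat.find_min' hex ((I.mul_unit_mem_iff_mem hw).mp hz)
  exact Ideal.mem_span_singleton.mpr ((pow_dvd_pow t hj).mul_right w)

lemma bot_colon_bot_colon_le {t : R} (ht : maximalIdeal R = Ideal.span {t}) (hnil : IsNilpotent t)
    (I : Ideal R) :
    (⊥ : Ideal R).colon ((⊥ : Ideal R).colon (I : Set R) : Set R) ≤ I := by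
  obtain ⟨i, rfl⟩ := exists_eq_span_singleton_pow ht hnil I
  obtain ⟨j, hj⟩ := exists_eq_span_singleton_pow ht hnil
    ((⊥ : Ideal R).colon ((⊥ : Ideal R).colon (Ideal.span {t ^ i} : Set R) : Set R))
  set n := nilpotencyClass t
  have hn : t ^ n = 0 := pow_nilpotencyClass hnil
  have hann : t ^ (n - i) ∈ (⊥ : Ideal R).colon (Ideal.span {t ^ i} : Set R) := by
    rw [Ideal.mem_colon_span_singleton, ← pow_add, pow_eq_zero_of_le (by lia) hn]
    exact zero_mem _
  have hzero : t ^ (j + (n - i)) = 0 := by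
    rw [pow_add]
    exact Submodule.mem_colon.mp (hj.ge (Ideal.mem_span_singleton_self _)) _ hann
  have hle : n ≤ j + (n - i) := Nat.sInf_le hzero
  rw [hj, Ideal.span_singleton_le_span_singleton]
  by_cases hij : i ≤ j
  · exact pow_dvd_pow t hij
  · rw [pow_eq_zero_of_le (by lia : n ≤ j) hn]
    exact dvd_zero _

lemma span_eq_bot_of_ringKrullDim_eq_zero {d : ℕ} {x : Fin d → R} (hx : IsSystemOfParameters x)
    (hdim : ringKrullDim R = 0) : Ideal.span (Set.range x) = ⊥ := by
  obtain rfl : d = 0 := by exact_mod_cast hx.1.symm.trans hdim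
  rw [Set.range_eq_empty x, Ideal.span_empty]

lemma colon_colon_le_of_ringKrullDim_eq_zero [IsNoetherianRing R] [Uncountable (ResidueField R)]
    (htype : HasCountableCMType R) (hdim : ringKrullDim R = 0) {d : ℕ} {x : Fin d → R}
    (hx : IsSystemOfParameters x) (I : Ideal R) :
    (Ideal.span (Set.range x)).colon ((Ideal.span (Set.range x)).colon (I : Set R) : Set R) ≤
      I := by
  obtain ⟨t, ht⟩ := exists_maximalIdeal_eq_span_singleton htype hdim
  have := ringKrullDimZero_iff_ringKrullDim_eq_zero.mpr hdim
  have hnil : IsNilpotent t := Ring.KrullDimLE.isNilpotent_iff_mem_maximalIdeal.mpr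
    (ht ▸ Ideal.mem_span_singleton_self t)
  rw [span_eq_bot_of_ringKrullDim_eq_zero hx hdim]
  exact bot_colon_bot_colon_le ht hnil I

end DimensionZero

end AlmostGorenstein

theorem corollary3p3 {R : Type u} [CommRing R] [IsLocalRing R] [IsNoetherianRing R]
    (hCM : IsMCM R R) (htype : HasCountableCMType R)
    (hk : Uncountable (IsLocalRing.ResidueField R)) :
    -- the double colon inclusion for general systems of parameters
    (∀ (d : ℕ) (x : Fin d → R), IsGeneralSOP x → ∀ I : Ideal R,
      IsLocalRing.maximalIdeal R *
          (Ideal.span (Set.range x)).colon ((Ideal.span (Set.range x)).colon (I : Set R) : Set R) ≤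
        Ideal.span (Set.range x) ⊔ I) ∧
    -- the version with coefficients in a maximal Cohen-Macaulay module
    (∀ (d : ℕ) (x : Fin d → R), IsGeneralSOP x →
      ∀ (M : Type u) [AddCommGroup M] [Module R M], IsMCM R M →
      ∀ a I : Ideal R, Ideal.span (Set.range x) ≤ a → a ≤ I →
      ∀ xM A B : Submodule R M,
        xM = Ideal.span (Set.range x) • (⊤ : Submodule R M) →
        A = moduleColon xM (a.colon (I : Set R)) →
        B = xM ⊔ I • moduleColon xM a →
        B ≤ A ∧ IsLocalRing.maximalIdeal R ≤ Module.annihilator R (A ⧸ B.submoduleOf A)) ∧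
    -- general systems of parameters exist in positive dimension
    (ringKrullDim R ≠ 0 → ∃ (d : ℕ) (x : Fin d → R), IsGeneralSOP x) ∧
    -- the ideals to be avoided are countably many and properly contained in the maximal ideal,
    -- and every parameter ideal `K` that lies in none of them satisfies `K : (K : I) ⊆ I : m` for
    -- all `I ⊇ K`; in dimension zero there is no condition on `K`
    ((avoidedIdeals R).Countable ∧
      (∀ J ∈ avoidedIdeals R, J < IsLocalRing.maximalIdeal R) ∧
      ∀ (d : ℕ) (x : Fin d → R) (K : Ideal R), IsSystemOfParameters x →
        K = Ideal.span (Set.range x) →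
        (ringKrullDim R = 0 ∨ ∀ J ∈ avoidedIdeals R, ¬ K ≤ J) →
        ∀ I : Ideal R, K ≤ I →
          K.colon (K.colon (I : Set R) : Set R) ≤
            I.colon (IsLocalRing.maximalIdeal R : Set R)) := by
  refine ⟨fun _ _ hx I ↦ maximalIdeal_mul_colon_colon_le hCM hx.1 hx.not_span_le I, ?_,
    exists_isGeneralSOP htype, countable_avoidedIdeals htype,
    fun _ ↦ lt_maximalIdeal_of_mem_avoidedIdeals, ?_⟩
  · rintro d x hx M _ _ hM a I hxa - _ _ _ rfl rfl rfl
    exact ⟨sup_smul_moduleColon_le _ a I, le_annihilator_quotient_submoduleOf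
      (maximalIdeal_smul_moduleColon_le hCM hx.1 hx.not_span_le hM hxa I)⟩
  · rintro d x K hx rfl (hdim | hK) I hKI
    · exact (colon_colon_le_of_ringKrullDim_eq_zero htype hdim hx I).trans Ideal.le_colon
    · exact le_colon_maximalIdeal
        ((maximalIdeal_mul_colon_colon_le hCM hx hK I).trans_eq (sup_eq_right.mpr hKI))
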